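/- Let $X$ be a finite multiset of nonzero vectors spanning $\mathbb R^n$, equipped with a total order $\le$ on its elements (counted with multiplicity). For $y\in\mathbb R^n$ let $p_y=\sum_{i=1}^n y(i)\,t_i\in\Pi:=\mathbb C[t_1,\dots,t_n]$; for a sub-multiset $Y\subseteq X$ let $p_Y=\prod_{y\in Y}p_y$, and let $\mathcal P_+(X)=\operatorname{span}_{\mathbb C}\{p_Y: Y\subseteq X\}$. Let $\mathbb I(X)$ be the collection of all linearly independent subsets of $X$ (including the empty set), where equal vectors occurring in $X$ with multiplicity are regarded as different elements. For $I\in\mathbb I(X)$ put $$X(I)=\{x\in X:\ x\notin\operatorname{span}\{b\in I: b\le x\}\},\qquad Q_I=p_{X(I)},\qquad \operatorname{val}(I)=\#X(I).$$ Then the family $(Q_I)_{I\in\mathbb I(X)}$ is a basis of $\mathcal P_+(X)$. Moreover, for every integer $j\ge 0$, the external Hilbert series $h_{X,+}(j):=\#\{I\in\mathbb I(X):\operatorname{val}(I)=j\}$ satisfies $$h_{X,+}(j)=\dim_{\mathbb C}\bigl(\mathcal P_+(X)\cap\Pi^0_j\bigr),$$ where $\Pi_j^0$ is the space of homogeneous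 polynomials of degree $j$ in $\Pi$ (including $0$). -/

import Mathlib

namespace Zonotopal

/-- The linear form `p_y = ∑ i, y(i) t_i`, as an element of `Π = ℂ[t_1, …, t_n]`. -/
noncomputable def linForm {n : ℕ} (y : Fin n → ℝ) : MvPolynomial (Fin n) ℂ :=
  ∑ i, MvPolynomial.C ((y i : ℝ) : ℂ) * MvPolynomial.X i

/-- `p_Y = ∏_{y ∈ Y} p_y`. The multiset `X` is a family of vectors `X : ι → ℝⁿ`, and a
sub-multiset `Y` of `X` is a finite set of indices. -/
noncomputable def prodForm {n : ℕ} {ι : Type*} (X : ι → Fin n → ℝ) (Y : Finset ι) :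
    MvPolynomial (Fin n) ℂ :=
  ∏ y ∈ Y, linForm (X y)

/-- `P_+(X) = span {p_Y : Y ⊆ X}`, a complex linear subspace of `Π`. -/
noncomputable def externalSpace {n : ℕ} {ι : Type*} (X : ι → Fin n → ℝ) :
    Submodule ℂ (MvPolynomial (Fin n) ℂ) :=
  Submodule.span ℂ (Set.range (prodForm X))

/-- `𝕀(X)`, the collection of all linearly independent subsets of the multiset `X`. -/
def IndepSubset {n : ℕ} {ι : Type*} (X : ι → Fin n → ℝ) : Type _ :=
  {I : Finset ι // LinearIndepOn ℝ X (I : Set ι)}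

open scoped Classical in
/-- `X(I) = {x ∈ X : x ∉ span {b ∈ I : b ≤ x}}`; the order on `X` is that of the index set. -/
noncomputable def complementSet {n : ℕ} {ι : Type*} [Fintype ι] [LinearOrder ι]
    (X : ι → Fin n → ℝ) (I : Finset ι) : Finset ι :=
  Finset.univ.filter fun x => X x ∉ Submodule.span ℝ (X '' {b | b ∈ I ∧ b ≤ x})

/-- `Q_I = p_{X(I)}`. -/
noncomputable def basisPoly {n : ℕ} {ι : Type*} [Fintype ι] [LinearOrder ι]
    (X : ι → Fin n → ℝ) (I : IndepSubset X) : MvPolynomial (Fin n) ℂ :=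
  prodForm X (complementSet X I.1)

/-- `val(I) = #X(I)`. -/
noncomputable def val {n : ℕ} {ι : Type*} [Fintype ι] [LinearOrder ι]
    (X : ι → Fin n → ℝ) (I : IndepSubset X) : ℕ :=
  (complementSet X I.1).card

/-- The external Hilbert series `h_{X,+}(j) = #{I ∈ 𝕀(X) : val(I) = j}`
(the collection `𝕀(X)` is finite). -/
noncomputable def externalHilbert {n : ℕ} {ι : Type*} [Fintype ι] [LinearOrder ι]
    (X : ι → Fin n → ℝ) (j : ℕ) : ℕ :=
  Nat.card {I : IndepSubset X // val X I = j}

end Zonotopal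

namespace Zonotopal

open Polynomial

/-! The proof is by deletion and restriction. Read each vector as a linear form on a real space `W`
and enlarge the span of the products to `kernelSpace X S`: the polynomial functions whose degree
along any direction η is at most the number of forms in `S` not vanishing at η. Every product p_Y
lies there. Let a be the least index, with `X a ≠ 0`. Multiplication by `X a` and restriction to its
kernel H relate the space of `insert a S` to that of `S` on `W` and that of the restricted forms on
H. The Q_I follow the same split: if a ∉ I, then Q_I is `X a` times the Q_I of `S`; if I = {a} ∪ J,
then Q_I restricts on H to Q_J. Induction yields independence and spanning together
(`activeProduct_linearIndependent_and_spanning`). The degree conditions are what make division work: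
a quotient by `X a` satisfies the bounds for `S` (`mem_kernelSpace_of_mul`), which is not evident
for a span of products. The Hilbert series follows because Q_I is homogeneous of degree val(I). -/

/-- Complex polynomials that agree at all nonzero real numbers are equal. -/
theorem polynomial_ext_real {p q : ℂ[X]}
    (h : ∀ t : ℝ, t ≠ 0 → p.eval (t : ℂ) = q.eval (t : ℂ)) : p = q := by
  apply Polynomial.eq_of_infinite_eval_eq
  have hinf : Set.Infinite ((fun t : ℝ => (t : ℂ)) '' {0}ᶜ) :=
    (Set.finite_singleton (0 : ℝ)).infinite_compl.image Complex.ofReal_injective.injOn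
  refine hinf.mono ?_
  rintro _ ⟨t, ht, rfl⟩
  exact h t ht

/-! ### Polynomial functions: division by a linear form and degree along lines. -/

section PolynomialFunctions

variable {W W' : Type*} [AddCommGroup W] [Module ℝ W] [AddCommGroup W'] [Module ℝ W']

/-- A real linear functional as a complex-valued function. -/
def complexForm (φ : Module.Dual ℝ W) : W → ℂ := fun w => ((φ w : ℝ) : ℂ)

@[simp] theorem complexForm_apply (φ : Module.Dual ℝ W) (w : W) :
    complexForm φ w = ((φ w : ℝ) : ℂ) := rfl

variable (W) in
/-- The algebra of complex-valued polynomial functions on a real vector space. -/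
def polynomialFunctions : Subalgebra ℂ (W → ℂ) :=
  Algebra.adjoin ℂ (Set.range complexForm)

theorem complexForm_mem (φ : Module.Dual ℝ W) : complexForm φ ∈ polynomialFunctions W :=
  Algebra.subset_adjoin ⟨φ, rfl⟩

theorem polynomialFunctions_comp (L : W' →ₗ[ℝ] W) {f : W → ℂ} (hf : f ∈ polynomialFunctions W) :
    f ∘ L ∈ polynomialFunctions W' := by
  induction hf using Algebra.adjoin_induction with
  | mem x hx =>
    obtain ⟨φ, rfl⟩ := hx
    exact complexForm_mem (φ.comp L)
  | algebraMap r => exact (polynomialFunctions W').algebraMap_mem r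
  | add x y _ _ hx hy => exact add_mem hx hy
  | mul x y _ _ hx hy => exact mul_mem hx hy

/-- A polynomial function restricted to an affine plane is a polynomial in two variables. -/
theorem exists_plane_polynomial {f : W → ℂ} (hf : f ∈ polynomialFunctions W) (w u η : W) :
    ∃ H : ℂ[X][X], ∀ s t : ℝ, f (w + s • u + t • η) = H.evalEval (s : ℂ) (t : ℂ) := by
  induction hf using Algebra.adjoin_induction with
  | mem x hx =>
    obtain ⟨φ, rfl⟩ := hx
    refine ⟨C (C ((φ w : ℝ) : ℂ) + C ((φ u : ℝ) : ℂ) * X) + C (C ((φ η : ℝ) : ℂ)) * X,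
      fun s t => ?_⟩
    simp [Polynomial.evalEval]
    ring
  | algebraMap r => exact ⟨C (C r), fun s t => by simp [Polynomial.evalEval]⟩
  | add x y _ _ hx hy =>
    obtain ⟨P, hP⟩ := hx
    obtain ⟨Q, hQ⟩ := hy
    exact ⟨P + Q, fun s t => by simp [Polynomial.evalEval_add, hP, hQ]⟩
  | mul x y _ _ hx hy =>
    obtain ⟨P, hP⟩ := hx
    obtain ⟨Q, hQ⟩ := hy
    exact ⟨P * Q, fun s t => by simp [Polynomial.evalEval_mul, hP, hQ]⟩

theorem exists_line_polynomial {f : W → ℂ} (hf : f ∈ polynomialFunctions W) (w η : W) :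
    ∃ q : ℂ[X], ∀ t : ℝ, f (w + t • η) = q.eval (t : ℂ) := by
  obtain ⟨H, hH⟩ := exists_plane_polynomial hf w 0 η
  refine ⟨H.map (evalRingHom 0), fun t => ?_⟩
  rw [map_evalRingHom_eval]
  simpa using hH 0 t

/-- A polynomial function with vanishing multiple by a nonzero linear form vanishes. -/
theorem eq_zero_of_complexForm_mul_eq_zero {φ : Module.Dual ℝ W} (hφ : φ ≠ 0) {g : W → ℂ}
    (hg : g ∈ polynomialFunctions W) (h : complexForm φ * g = 0) : g = 0 := by
  obtain ⟨u, hu⟩ : ∃ u, φ u ≠ 0 := by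
    by_contra! hc
    exact hφ (LinearMap.ext hc)
  funext w
  by_cases hw : φ w = 0
  · obtain ⟨q, hq⟩ := exists_line_polynomial hg w u
    have hq0 : q = 0 := by
      refine polynomial_ext_real fun t ht => ?_
      have h1 := congrFun h (w + t • u)
      simp only [Pi.mul_apply, complexForm_apply, map_add, map_smul, hw, zero_add, smul_eq_mul,
        Pi.zero_apply, mul_eq_zero, Complex.ofReal_eq_zero, ht, hu, or_self, false_or] at h1
      rw [← hq, h1, eval_zero]
    simpa [hq0] using hq 0
  · have h1 := congrFun h w
    simpa [hw] using h1

/-- A polynomial function vanishing on the kernel of a nonzero linear form is divisible by it. -/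
theorem exists_eq_complexForm_mul {φ : Module.Dual ℝ W} (hφ : φ ≠ 0) {f : W → ℂ}
    (hf : f ∈ polynomialFunctions W) (h : ∀ w, φ w = 0 → f w = 0) :
    ∃ g ∈ polynomialFunctions W, f = complexForm φ * g := by
  obtain ⟨v, hv⟩ : ∃ u, φ u ≠ 0 := by
    by_contra! hc
    exact hφ (LinearMap.ext hc)
  set u : W := (φ v)⁻¹ • v with hu_def
  have hu : φ u = 1 := by simp [hu_def, hv]
  -- π projects onto the kernel of φ along u, so f ∘ π = 0 under the hypothesis and it suffices to
  -- divide f - f ∘ π by φ.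
  let π : W →ₗ[ℝ] W := LinearMap.id - φ.smulRight u
  have hπ : ∀ w, π w = w - φ w • u := fun w => rfl
  have key : ∃ g ∈ polynomialFunctions W, f - f ∘ π = complexForm φ * g := by
    clear h
    induction hf using Algebra.adjoin_induction with
    | mem x hx =>
      obtain ⟨ψ, rfl⟩ := hx
      refine ⟨algebraMap ℂ _ ((ψ u : ℝ) : ℂ), Subalgebra.algebraMap_mem _ _, ?_⟩
      funext w
      simp [hπ]
    | algebraMap r => exact ⟨0, zero_mem _, by funext w; simp⟩
    | add x y _ _ hx hy =>
      obtain ⟨g, hg, hxg⟩ := hx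
      obtain ⟨k, hk, hyk⟩ := hy
      refine ⟨g + k, add_mem hg hk, ?_⟩
      rw [mul_add, ← hxg, ← hyk]
      funext w
      simp
      ring
    | mul x y hx' hy' hx hy =>
      obtain ⟨g, hg, hxg⟩ := hx
      obtain ⟨k, hk, hyk⟩ := hy
      -- From xy - (x∘π)(y∘π) = (x - x∘π)y + (x∘π)(y - y∘π).
      refine ⟨g * y + (x ∘ π) * k,
        add_mem (mul_mem hg hy') (mul_mem (polynomialFunctions_comp π hx') hk), ?_⟩
      rw [mul_add, ← mul_assoc, ← hxg, mul_left_comm, ← hyk]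
      funext w
      simp
      ring
  obtain ⟨g, hg, hfg⟩ := key
  refine ⟨g, hg, ?_⟩
  rw [← hfg]
  funext w
  have : f (π w) = 0 := h _ (by simp [hπ, hu])
  simp [this]

/-- The function `f` has degree at most `m` along every line in direction `η`. -/
def DegreeLEAlong (η : W) (m : ℕ) (f : W → ℂ) : Prop :=
  ∀ w, ∃ p : ℂ[X], p.natDegree ≤ m ∧ ∀ t : ℝ, f (w + t • η) = p.eval (t : ℂ)

theorem DegreeLEAlong.add {η : W} {m : ℕ} {f g : W → ℂ} (hf : DegreeLEAlong η m f)
    (hg : DegreeLEAlong η m g) : DegreeLEAlong η m (f + g) := fun w => by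
  obtain ⟨p, hp, hfp⟩ := hf w
  obtain ⟨q, hq, hgq⟩ := hg w
  exact ⟨p + q, natDegree_add_le_of_degree_le hp hq, fun t => by simp [hfp, hgq]⟩

theorem DegreeLEAlong.smul {η : W} {m : ℕ} {f : W → ℂ} (c : ℂ) (hf : DegreeLEAlong η m f) :
    DegreeLEAlong η m (c • f) := fun w => by
  obtain ⟨p, hp, hfp⟩ := hf w
  exact ⟨c • p, (natDegree_smul_le c p).trans hp, fun t => by simp [hfp]⟩

theorem DegreeLEAlong.mul {η : W} {m k : ℕ} {f g : W → ℂ} (hf : DegreeLEAlong η m f)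
    (hg : DegreeLEAlong η k g) : DegreeLEAlong η (m + k) (f * g) := fun w => by
  obtain ⟨p, hp, hfp⟩ := hf w
  obtain ⟨q, hq, hgq⟩ := hg w
  exact ⟨p * q, natDegree_mul_le_of_le hp hq, fun t => by simp [hfp, hgq]⟩

theorem DegreeLEAlong.mono {η : W} {m k : ℕ} {f : W → ℂ} (hf : DegreeLEAlong η m f)
    (hmk : m ≤ k) : DegreeLEAlong η k f := fun w => by
  obtain ⟨p, hp, hfp⟩ := hf w
  exact ⟨p, hp.trans hmk, hfp⟩

theorem degreeLEAlong_complexForm (η : W) (φ : Module.Dual ℝ W) :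
    DegreeLEAlong η (if φ η ≠ 0 then 1 else 0) (complexForm φ) := fun w => by
  refine ⟨C ((φ η : ℝ) : ℂ) * X + C ((φ w : ℝ) : ℂ), ?_, fun t => by simp; ring⟩
  split_ifs with h
  · exact natDegree_linear_le
  · have : φ η = 0 := by simpa using h
    simp [this]

/-- Division by a linear form that is not constant in direction `η` lowers the degree. -/
theorem DegreeLEAlong.of_mul_of_ne {η : W} {m : ℕ} {φ : Module.Dual ℝ W} (hη : φ η ≠ 0)
    {g : W → ℂ} (hg : g ∈ polynomialFunctions W)
    (h : DegreeLEAlong η (m + 1) (complexForm φ * g)) : DegreeLEAlong η m g := fun w => by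
  obtain ⟨q, hq⟩ := exists_line_polynomial hg w η
  obtain ⟨p, hp, hfp⟩ := h w
  refine ⟨q, ?_, hq⟩
  have hne : ((φ η : ℝ) : ℂ) ≠ 0 := by simpa using hη
  have hpq : p = (C ((φ η : ℝ) : ℂ) * X + C ((φ w : ℝ) : ℂ)) * q := by
    refine polynomial_ext_real fun t _ => ?_
    rw [← hfp]
    simp [hq, -mul_eq_mul_right_iff]
    ring
  by_cases hq0 : q = 0
  · simp [hq0]
  have hlin : (C ((φ η : ℝ) : ℂ) * X + C ((φ w : ℝ) : ℂ)) ≠ 0 := by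
    intro h0
    have := natDegree_linear (b := ((φ w : ℝ) : ℂ)) hne
    simp [h0] at this
  rw [hpq, natDegree_mul hlin hq0, natDegree_linear hne] at hp
  omega

/-- Division by a nonzero linear form that is constant in direction `η` keeps the degree. -/
theorem DegreeLEAlong.of_mul_of_eq {η : W} {m : ℕ} {φ : Module.Dual ℝ W} (hφ : φ ≠ 0)
    (hη : φ η = 0) {g : W → ℂ} (hg : g ∈ polynomialFunctions W)
    (h : DegreeLEAlong η m (complexForm φ * g)) : DegreeLEAlong η m g := by
  -- Off the hyperplane, φ is a nonzero constant along the line and can be divided out.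
  have main : ∀ w, φ w ≠ 0 → ∃ p : ℂ[X], p.natDegree ≤ m ∧
      ∀ t : ℝ, g (w + t • η) = p.eval (t : ℂ) := by
    intro w hw
    obtain ⟨p, hp, hfp⟩ := h w
    refine ⟨((φ w : ℝ) : ℂ)⁻¹ • p, (natDegree_smul_le _ p).trans hp, fun t => ?_⟩
    have hne : ((φ w : ℝ) : ℂ) ≠ 0 := by simpa using hw
    rw [eval_smul, ← hfp]
    simp [hη, hne]
  intro w
  by_cases hw : φ w = 0
  swap
  · exact main w hw
  obtain ⟨u, hu⟩ : ∃ u, φ u ≠ 0 := by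
    by_contra! hc
    exact hφ (LinearMap.ext hc)
  obtain ⟨H, hH⟩ := exists_plane_polynomial hg w u η
  -- The hyperplane itself is reached by perturbing in direction u: each coefficient of t^k with k >
  -- m is a polynomial in s vanishing for all real s ≠ 0, hence also at s = 0.
  have hdeg : H.natDegree ≤ m := by
    rw [natDegree_le_iff_coeff_eq_zero]
    intro k hk
    refine polynomial_ext_real fun s hs => ?_
    obtain ⟨p, hp, hgp⟩ := main (w + s • u) (by simp [hw, hs, hu])
    have hpH : p = H.map (evalRingHom (s : ℂ)) := by
      refine polynomial_ext_real fun t _ => ?_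
      rw [← hgp, hH, map_evalRingHom_eval]
    have := coeff_eq_zero_of_natDegree_lt (hp.trans_lt hk)
    rw [hpH, coeff_map] at this
    simpa using this
  refine ⟨H.map (evalRingHom 0), natDegree_map_le.trans hdeg, fun t => ?_⟩
  rw [map_evalRingHom_eval]
  simpa using hH 0 t

end PolynomialFunctions

/-! ### Independent subsets and active complements under deletion and contraction. -/

section IndependentSubsets

variable {ι M M' : Type*} [AddCommGroup M] [Module ℝ M] [AddCommGroup M']
  [Module ℝ M']

open scoped Classical in
/-- The linearly independent subsets of the finite subfamily of `X` indexed by `S`. -/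
noncomputable def indepSubsets (X : ι → M) (S : Finset ι) : Finset (Finset ι) :=
  S.powerset.filter fun I => LinearIndepOn ℝ X (I : Set ι)

theorem mem_indepSubsets {X : ι → M} {S I : Finset ι} :
    I ∈ indepSubsets X S ↔ I ⊆ S ∧ LinearIndepOn ℝ X (I : Set ι) := by
  simp [indepSubsets]

theorem map_mem_span_image_iff {ρ : M →ₗ[ℝ] M'} {v : M} (hρ : LinearMap.ker ρ = ℝ ∙ v) (z : M)
    (T : Set M) : ρ z ∈ Submodule.span ℝ (ρ '' T) ↔ z ∈ Submodule.span ℝ (insert v T) := by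
  rw [← Submodule.map_span, ← Submodule.mem_comap, Submodule.comap_map_eq, hρ,
    Submodule.span_insert, sup_comm]

/-- Matroid contraction: ρ is the quotient by the line of `X a`. -/
theorem linearIndepOn_insert_iff_map {ρ : M →ₗ[ℝ] M'} {X : ι → M} {a : ι}
    (hρ : LinearMap.ker ρ = ℝ ∙ X a) (ha : X a ≠ 0) {J : Set ι} (haJ : a ∉ J) :
    LinearIndepOn ℝ X (insert a J) ↔ LinearIndepOn ℝ (ρ ∘ X) J := by
  rw [linearIndepOn_insert haJ]
  constructor
  · rintro ⟨hJ, hnot⟩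
    refine (LinearMap.linearIndependent_iff_of_disjoint ρ ?_).2 hJ
    rw [hρ, Submodule.disjoint_span_singleton' ha]
    rwa [Set.image_eq_range] at hnot
  · intro h
    refine ⟨LinearIndependent.of_comp ρ h, fun hmem => ?_⟩
    rw [Finsupp.mem_span_image_iff_linearCombination] at hmem
    obtain ⟨l, hl, hla⟩ := hmem
    have hl0 : l = 0 := by
      refine linearIndepOn_iff.1 h l hl ?_
      rw [← Finsupp.apply_linearCombination, hla]
      have : X a ∈ LinearMap.ker ρ := by
        rw [hρ]
        exact Submodule.mem_span_singleton_self _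
      exact this
    exact ha (by rw [← hla, hl0, map_zero])

variable [LinearOrder ι]

open scoped Classical in
/-- The elements `x` of `S` with `X x` outside the span of the vectors `X b`, `b ∈ I`, `b ≤ x`. -/
noncomputable def activeComplement (X : ι → M) (S I : Finset ι) : Finset ι :=
  S.filter fun x => X x ∉ Submodule.span ℝ (X '' {b | b ∈ I ∧ b ≤ x})

theorem mem_activeComplement {X : ι → M} {S I : Finset ι} {x : ι} :
    x ∈ activeComplement X S I ↔
      x ∈ S ∧ X x ∉ Submodule.span ℝ (X '' {b | b ∈ I ∧ b ≤ x}) := by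
  simp [activeComplement]

section Insert

variable {X : ι → M} {a : ι} {S : Finset ι}

theorem indepSubsets_insert_of_eq_zero (ha : X a = 0) :
    indepSubsets X (insert a S) = indepSubsets X S := by
  ext I
  rw [mem_indepSubsets, mem_indepSubsets]
  refine ⟨fun ⟨hI, hli⟩ => ⟨fun x hx => ?_, hli⟩, fun ⟨hI, hli⟩ =>
    ⟨hI.trans (Finset.subset_insert _ _), hli⟩⟩
  rcases Finset.mem_insert.1 (hI hx) with rfl | h
  · exact absurd ha (hli.ne_zero hx)
  · exact h

theorem activeComplement_insert_of_eq_zero (ha : X a = 0) (I : Finset ι) :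
    activeComplement X (insert a S) I = activeComplement X S I := by
  ext x
  rw [mem_activeComplement, mem_activeComplement, Finset.mem_insert]
  constructor
  · rintro ⟨rfl | hx, h⟩
    · exact absurd (ha ▸ Submodule.zero_mem _) h
    · exact ⟨hx, h⟩
  · exact fun ⟨hx, h⟩ => ⟨Or.inr hx, h⟩

/-- No element of J is ≤ a, so a is tested against the zero span and is active. -/
theorem activeComplement_insert_of_lt (haS : ∀ x ∈ S, a < x) (ha : X a ≠ 0) {J : Finset ι}
    (hJ : J ⊆ S) :
    activeComplement X (insert a S) J = insert a (activeComplement X S J) := by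
  ext x
  simp only [mem_activeComplement, Finset.mem_insert]
  constructor
  · rintro ⟨rfl | hx, h⟩
    · exact Or.inl rfl
    · exact Or.inr ⟨hx, h⟩
  · rintro (rfl | ⟨hx, h⟩)
    · refine ⟨Or.inl rfl, ?_⟩
      have : {b | b ∈ J ∧ b ≤ x} = ∅ := by
        ext b
        simp only [Set.mem_ofPred_eq, Set.mem_empty_iff_false, iff_false, not_and, not_le]
        exact fun hb => haS b (hJ hb)
      simpa [this] using ha
    · exact ⟨Or.inr hx, h⟩

/-- Minimality puts a among the b ≤ x for every x in `S`, so each span contains `X a` and can be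
tested modulo it. -/
theorem activeComplement_insert_insert {ρ : M →ₗ[ℝ] M'} (hρ : LinearMap.ker ρ = ℝ ∙ X a)
    (haS : ∀ x ∈ S, a < x) (J : Finset ι) :
    activeComplement X (insert a S) (insert a J) = activeComplement (ρ ∘ X) S J := by
  have key : ∀ x ∈ S, (X x ∈ Submodule.span ℝ (X '' {b | b ∈ insert a J ∧ b ≤ x}) ↔
      (ρ ∘ X) x ∈ Submodule.span ℝ ((ρ ∘ X) '' {b | b ∈ J ∧ b ≤ x})) := by
    intro x hx
    have hset : {b | b ∈ insert a J ∧ b ≤ x} = insert a {b | b ∈ J ∧ b ≤ x} := by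
      ext b
      simp only [Finset.mem_insert, Set.mem_ofPred_eq, Set.mem_insert_iff]
      constructor
      · rintro ⟨rfl | hb, hbx⟩
        · exact Or.inl rfl
        · exact Or.inr ⟨hb, hbx⟩
      · rintro (rfl | ⟨hb, hbx⟩)
        · exact ⟨Or.inl rfl, (haS x hx).le⟩
        · exact ⟨Or.inr hb, hbx⟩
    rw [hset, Set.image_insert_eq, Set.image_comp, Function.comp_apply,
      map_mem_span_image_iff hρ]
  ext x
  rw [mem_activeComplement, mem_activeComplement, Finset.mem_insert]
  constructor
  · rintro ⟨rfl | hx, h⟩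
    · exact absurd (Submodule.subset_span
        (Set.mem_image_of_mem X (by simp))) h
    · exact ⟨hx, (key x hx).not.1 h⟩
  · exact fun ⟨hx, h⟩ => ⟨Or.inr hx, (key x hx).not.2 h⟩

theorem sum_indepSubsets_insert {N : Type*} [AddCommMonoid N] {ρ : M →ₗ[ℝ] M'}
    (hρ : LinearMap.ker ρ = ℝ ∙ X a) (haS : a ∉ S) (ha : X a ≠ 0) (F : Finset ι → N) :
    ∑ I ∈ indepSubsets X (insert a S), F I =
      ∑ J ∈ indepSubsets X S, F J + ∑ J ∈ indepSubsets (ρ ∘ X) S, F (insert a J) := by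
  classical
  rw [indepSubsets, Finset.sum_filter, Finset.sum_powerset_insert haS, indepSubsets, indepSubsets,
    Finset.sum_filter, Finset.sum_filter]
  congr 1
  refine Finset.sum_congr rfl fun J hJ => ?_
  have haJ : a ∉ (J : Set ι) := fun h => haS (Finset.mem_powerset.1 hJ h)
  rw [Finset.coe_insert, linearIndepOn_insert_iff_map hρ ha haJ]

end Insert

end IndependentSubsets

/-! ### The space cut out by directional degree bounds. -/

section KernelSpace

variable {ι W : Type*} [AddCommGroup W] [Module ℝ W]

/-- The polynomial functions whose degree along each direction `η` is at most the number of
forms `X x`, `x ∈ S`, that do not vanish at `η`. -/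
noncomputable def kernelSpace (X : ι → Module.Dual ℝ W) (S : Finset ι) : Submodule ℂ (W → ℂ) where
  carrier := {f | f ∈ polynomialFunctions W ∧
    ∀ η, DegreeLEAlong η (∑ x ∈ S, if X x η ≠ 0 then 1 else 0) f}
  zero_mem' := ⟨zero_mem _, fun η w => ⟨0, by simp, by simp⟩⟩
  add_mem' hf hg := ⟨add_mem hf.1 hg.1, fun η => (hf.2 η).add (hg.2 η)⟩
  smul_mem' c _ hf := ⟨Subalgebra.smul_mem _ hf.1 c, fun η => (hf.2 η).smul c⟩

theorem prod_complexForm_mem_kernelSpace (X : ι → Module.Dual ℝ W) {Y S : Finset ι} (h : Y ⊆ S) :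
    ∏ y ∈ Y, complexForm (X y) ∈ kernelSpace X S := by
  classical
  refine ⟨prod_mem fun y _ => complexForm_mem _, fun η => ?_⟩
  refine DegreeLEAlong.mono ?_ (Finset.sum_le_sum_of_subset h)
  induction Y using Finset.induction_on with
  | empty => exact fun w => ⟨1, by simp, by simp⟩
  | insert y Y hy ih =>
    rw [Finset.prod_insert hy, Finset.sum_insert hy]
    exact (degreeLEAlong_complexForm η (X y)).mul (ih ((Finset.subset_insert _ _).trans h))

/-- With no forms the degree is 0 along every line, in particular along lines through the origin. -/
theorem kernelSpace_empty (X : ι → Module.Dual ℝ W) {f : W → ℂ} (hf : f ∈ kernelSpace X ∅) :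
    f = f 0 • 1 := by
  funext w
  obtain ⟨p, hp, hfp⟩ := hf.2 w 0
  obtain ⟨c, rfl⟩ := Polynomial.natDegree_eq_zero.1 (Nat.le_zero.1 hp)
  have h0 := hfp 0
  have h1 := hfp 1
  simp only [zero_smul, one_smul, zero_add, Polynomial.eval_C] at h0 h1
  simp [h0, h1]

/-- Deleting a lowers the bound at η by one exactly when `X a η ≠ 0`, which is when division by `X
a` lowers the degree. -/
theorem mem_kernelSpace_of_mul [DecidableEq ι] {X : ι → Module.Dual ℝ W} {a : ι} {S : Finset ι}
    (haS : a ∉ S) (ha : X a ≠ 0) {g : W → ℂ} (hg : g ∈ polynomialFunctions W)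
    (h : complexForm (X a) * g ∈ kernelSpace X (insert a S)) : g ∈ kernelSpace X S := by
  refine ⟨hg, fun η => ?_⟩
  have hη := h.2 η
  rw [Finset.sum_insert haS] at hη
  by_cases h0 : X a η = 0
  · exact DegreeLEAlong.of_mul_of_eq ha h0 hg (by simpa [h0] using hη)
  · refine DegreeLEAlong.of_mul_of_ne h0 hg ?_
    rw [if_pos h0, add_comm] at hη
    exact hη

/-- Restriction of linear functionals to a subspace. -/
def restrictDual (U : Submodule ℝ W) : Module.Dual ℝ W →ₗ[ℝ] Module.Dual ℝ U :=
  U.subtype.dualMap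

theorem restrictDual_apply (U : Submodule ℝ W) (φ : Module.Dual ℝ W) (w : U) :
    restrictDual U φ w = φ w := rfl

theorem ker_restrictDual_ker (φ : Module.Dual ℝ W) :
    LinearMap.ker (restrictDual (LinearMap.ker φ)) = ℝ ∙ φ := by
  ext ψ
  rw [LinearMap.mem_ker]
  constructor
  · intro h
    have := mem_span_of_iInf_ker_le_ker (ι := Unit) (L := fun _ => φ) (K := ψ) (by
      intro w hw
      simp only [iInf_const] at hw
      exact LinearMap.congr_fun h ⟨w, hw⟩)
    simpa using this
  · intro h
    obtain ⟨c, rfl⟩ := Submodule.mem_span_singleton.1 h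
    ext w
    simp [restrictDual_apply]

/-- Directions inside the hyperplane kill `X a`, so a contributes nothing to their bounds. -/
theorem comp_subtype_mem_kernelSpace [DecidableEq ι] {X : ι → Module.Dual ℝ W} {a : ι}
    {S : Finset ι} (haS : a ∉ S) {f : W → ℂ} (hf : f ∈ kernelSpace X (insert a S)) :
    f ∘ (LinearMap.ker (X a)).subtype ∈
      kernelSpace (restrictDual (LinearMap.ker (X a)) ∘ X) S := by
  refine ⟨polynomialFunctions_comp _ hf.1, fun η w => ?_⟩
  obtain ⟨p, hp, hfp⟩ := hf.2 (η : W) w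
  have h0 : X a (η : W) = 0 := η.2
  rw [Finset.sum_insert haS, if_neg (not_not.2 h0), zero_add] at hp
  refine ⟨p, hp, fun t => ?_⟩
  rw [← hfp]
  rfl

end KernelSpace

/-! ### The products Q_I form a basis of the kernel space. -/

section Basis

variable {ι : Type*} [LinearOrder ι]

/-- The product of the forms in the active complement of `I`. -/
noncomputable def activeProduct {W : Type*} [AddCommGroup W] [Module ℝ W]
    (X : ι → Module.Dual ℝ W) (S I : Finset ι) : W → ℂ :=
  ∏ x ∈ activeComplement X S I, complexForm (X x)

theorem activeProduct_mem_kernelSpace {W : Type*} [AddCommGroup W] [Module ℝ W]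
    (X : ι → Module.Dual ℝ W) (S I : Finset ι) : activeProduct X S I ∈ kernelSpace X S :=
  prod_complexForm_mem_kernelSpace X fun _ hx => (mem_activeComplement.1 hx).1

theorem activeProduct_insert_of_lt {W : Type*} [AddCommGroup W] [Module ℝ W]
    {X : ι → Module.Dual ℝ W} {a : ι} {S J : Finset ι} (haS : ∀ x ∈ S, a < x) (ha : X a ≠ 0)
    (hJ : J ⊆ S) :
    activeProduct X (insert a S) J = complexForm (X a) * activeProduct X S J := by
  rw [activeProduct, activeComplement_insert_of_lt haS ha hJ, Finset.prod_insert]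
  · rfl
  · exact fun h => (haS a (mem_activeComplement.1 h).1).false

theorem activeProduct_insert_insert_comp {W : Type*} [AddCommGroup W] [Module ℝ W]
    {X : ι → Module.Dual ℝ W} {a : ι} {S : Finset ι} (haS : ∀ x ∈ S, a < x) (J : Finset ι) :
    activeProduct X (insert a S) (insert a J) ∘ (LinearMap.ker (X a)).subtype =
      activeProduct (restrictDual (LinearMap.ker (X a)) ∘ X) S J := by
  funext w
  rw [activeProduct, activeProduct,
    activeComplement_insert_insert (ker_restrictDual_ker (X a)) haS]
  simp [Finset.prod_apply, restrictDual_apply]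

/-- `W` is quantified inside the induction because the step passes to a hyperplane. Zero forms must
be allowed: forms parallel to `X a` restrict to zero. -/
theorem activeProduct_linearIndependent_and_spanning (S : Finset ι) :
    ∀ (W : Type) [AddCommGroup W] [Module ℝ W] (X : ι → Module.Dual ℝ W),
      (∀ c : Finset ι → ℂ, ∑ I ∈ indepSubsets X S, c I • activeProduct X S I = 0 →
        ∀ I ∈ indepSubsets X S, c I = 0) ∧
      ∀ f ∈ kernelSpace X S, ∃ c : Finset ι → ℂ,
        f = ∑ I ∈ indepSubsets X S, c I • activeProduct X S I := by
  induction S using Finset.induction_on_min with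
  | empty =>
    intro W _ _ X
    have hI : indepSubsets X ∅ = {∅} := by
      ext I
      rw [mem_indepSubsets, Finset.subset_empty, Finset.mem_singleton]
      refine ⟨fun h => h.1, ?_⟩
      rintro rfl
      exact ⟨rfl, by simp⟩
    have hQ : activeProduct X ∅ ∅ = 1 := by simp [activeProduct, activeComplement]
    rw [hI]
    refine ⟨fun c hc I hI' => ?_, fun f hf => ⟨fun _ => f 0, ?_⟩⟩
    · rw [Finset.mem_singleton] at hI'
      subst hI'
      simpa [hQ] using congrFun hc 0
    · rw [Finset.sum_singleton, hQ]
      exact kernelSpace_empty X hf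
  | insert a S haS ih =>
    intro W _ _ X
    have haS' : a ∉ S := fun h => (haS a h).false
    by_cases ha : X a = 0
    · have hQ : activeProduct X (insert a S) = activeProduct X S := by
        funext I
        rw [activeProduct, activeProduct, activeComplement_insert_of_eq_zero ha]
      have hK : kernelSpace X (insert a S) = kernelSpace X S := by
        ext f
        simp [kernelSpace, Finset.sum_insert haS', ha]
      rw [indepSubsets_insert_of_eq_zero ha, hQ, hK]
      exact ih W X
    set ρ := restrictDual (LinearMap.ker (X a)) with hρ_def
    have hρ : LinearMap.ker ρ = ℝ ∙ X a := ker_restrictDual_ker (X a)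
    obtain ⟨ihA, ihB⟩ := ih W X
    obtain ⟨ihA', ihB'⟩ := ih (LinearMap.ker (X a)) (ρ ∘ X)
    have hsum : ∀ c : Finset ι → ℂ,
        ∑ I ∈ indepSubsets X (insert a S), c I • activeProduct X (insert a S) I =
        complexForm (X a) * ∑ J ∈ indepSubsets X S, c J • activeProduct X S J +
        ∑ J ∈ indepSubsets (ρ ∘ X) S,
          c (insert a J) • activeProduct X (insert a S) (insert a J) := by
      intro c
      rw [sum_indepSubsets_insert hρ haS' ha, Finset.mul_sum]
      congr 1
      refine Finset.sum_congr rfl fun J hJ => ?_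
      rw [activeProduct_insert_of_lt haS ha (mem_indepSubsets.1 hJ).1, mul_smul_comm]
    have hrestrict : ∀ (c : Finset ι → ℂ) (w : LinearMap.ker (X a)),
        (∑ J ∈ indepSubsets (ρ ∘ X) S,
          c J • activeProduct X (insert a S) (insert a J)) w =
        (∑ J ∈ indepSubsets (ρ ∘ X) S, c J • activeProduct (ρ ∘ X) S J) w := by
      intro c w
      rw [Finset.sum_apply, Finset.sum_apply]
      refine Finset.sum_congr rfl fun J _ => ?_
      rw [hρ_def, ← activeProduct_insert_insert_comp haS]
      rfl
    constructor
    · intro c hc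
      rw [hsum] at hc
      -- On the hyperplane the multiples of `X a` vanish, leaving a relation among the restricted
      -- products.
      have h1 := ihA' (fun J => c (insert a J)) (by
        funext w
        rw [← hrestrict (fun J => c (insert a J))]
        have hw : X a w = 0 := w.2
        simpa [hw] using congrFun hc w)
      have h2 : ∑ J ∈ indepSubsets X S, c J • activeProduct X S J = 0 := by
        refine eq_zero_of_complexForm_mul_eq_zero ha ?_ ?_
        · exact (Submodule.sum_mem (kernelSpace X S) fun J _ =>
            Submodule.smul_mem _ (c J) (activeProduct_mem_kernelSpace X S J)).1
        · rw [← hc, Finset.sum_eq_zero (s := indepSubsets (ρ ∘ X) S), add_zero]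
          intro J hJ
          rw [h1 J hJ, zero_smul]
      intro I hI
      obtain ⟨hIS, hIli⟩ := mem_indepSubsets.1 hI
      by_cases haI : a ∈ I
      · have hnot : a ∉ ((I.erase a : Finset ι) : Set ι) := by simp
        have hmem : I.erase a ∈ indepSubsets (ρ ∘ X) S := by
          refine mem_indepSubsets.2 ⟨Finset.subset_insert_iff.1 hIS, ?_⟩
          rw [← linearIndepOn_insert_iff_map hρ ha hnot, ← Finset.coe_insert,
            Finset.insert_erase haI]
          exact hIli
        simpa [Finset.insert_erase haI] using h1 _ hmem
      · exact ihA c h2 I (mem_indepSubsets.2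
          ⟨(Finset.subset_insert_iff_of_notMem haI).1 hIS, hIli⟩)
    · intro f hf
      obtain ⟨c', hc'⟩ := ihB' _ (comp_subtype_mem_kernelSpace haS' hf)
      -- r lifts the expansion of the restriction of f; f - r vanishes on the hyperplane and is
      -- divisible by `X a`.
      set r := ∑ J ∈ indepSubsets (ρ ∘ X) S,
        c' J • activeProduct X (insert a S) (insert a J) with hr
      have hrK : r ∈ kernelSpace X (insert a S) := Submodule.sum_mem _ fun J _ =>
        Submodule.smul_mem _ _ (activeProduct_mem_kernelSpace X _ _)
      have hfr := Submodule.sub_mem _ hf hrK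
      obtain ⟨g, hg, hfg⟩ := exists_eq_complexForm_mul ha hfr.1 (by
        intro w hw
        have h1 := congrFun hc' ⟨w, hw⟩
        rw [← hrestrict] at h1
        exact sub_eq_zero.2 h1)
      obtain ⟨c, hc⟩ := ihB g (mem_kernelSpace_of_mul haS' ha hg (hfg ▸ hfr))
      refine ⟨fun I => if a ∈ I then c' (I.erase a) else c I, ?_⟩
      rw [hsum, sub_eq_iff_eq_add.1 hfg, hc, hr]
      congr 1
      · congr 1
        refine Finset.sum_congr rfl fun J hJ => ?_
        rw [if_neg fun h => haS' ((mem_indepSubsets.1 hJ).1 h)]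
      · refine Finset.sum_congr rfl fun J hJ => ?_
        have haJ : a ∉ J := fun h => haS' ((mem_indepSubsets.1 hJ).1 h)
        rw [if_pos (Finset.mem_insert_self a J), Finset.erase_insert haJ]

end Basis

/-! ### Transfer to complex polynomials, and the grading. -/

section Evaluation

variable {n : ℕ}

/-- Evaluation of complex polynomials at real points. -/
noncomputable def evalReal (n : ℕ) : MvPolynomial (Fin n) ℂ →ₐ[ℂ] ((Fin n → ℝ) → ℂ) :=
  MvPolynomial.aeval fun i w => ((w i : ℝ) : ℂ)

theorem evalReal_apply (p : MvPolynomial (Fin n) ℂ) (w : Fin n → ℝ) :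
    evalReal n p w = MvPolynomial.eval (fun i => ((w i : ℝ) : ℂ)) p := by
  induction p using MvPolynomial.induction_on with
  | C a => simp [evalReal]
  | add p q hp hq => simp [hp, hq]
  | mul_X p i hp =>
    rw [map_mul, map_mul, Pi.mul_apply, hp]
    simp [evalReal]

/-- Real points suffice, since ℝ is infinite in each complex coordinate. -/
theorem evalReal_injective : Function.Injective (evalReal n) := by
  intro p q h
  refine MvPolynomial.funext_set (fun _ => Set.range fun t : ℝ => (t : ℂ))
    (fun _ => Set.infinite_range_of_injective Complex.ofReal_injective) fun x hx => ?_
  choose w hw using fun i => hx i (Set.mem_univ i)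
  obtain rfl : (fun i => ((w i : ℝ) : ℂ)) = x := funext hw
  rw [← evalReal_apply, ← evalReal_apply, h]

theorem evalReal_linForm (y : Fin n → ℝ) :
    evalReal n (linForm y) = complexForm (dotProductEquiv ℝ (Fin n) y) := by
  funext w
  simp [evalReal_apply, linForm, dotProduct]

variable {ι : Type*} (X : ι → Fin n → ℝ)

/-- The vectors of the family as linear functionals through the dot product. -/
noncomputable def dualFamily : ι → Module.Dual ℝ (Fin n → ℝ) :=
  (dotProductEquiv ℝ (Fin n) : (Fin n → ℝ) →ₗ[ℝ] Module.Dual ℝ (Fin n → ℝ)) ∘ X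

theorem evalReal_prodForm (Y : Finset ι) :
    evalReal n (prodForm X Y) = ∏ y ∈ Y, complexForm (dualFamily X y) := by
  rw [prodForm, map_prod]
  exact Finset.prod_congr rfl fun y _ => evalReal_linForm _

theorem linearIndepOn_dualFamily {I : Set ι} :
    LinearIndepOn ℝ (dualFamily X) I ↔ LinearIndepOn ℝ X I :=
  LinearMap.linearIndependent_iff _ (LinearEquiv.ker _)

variable [Fintype ι]

theorem mem_indepSubsets_dualFamily {I : Finset ι} :
    I ∈ indepSubsets (dualFamily X) Finset.univ ↔ LinearIndepOn ℝ X (I : Set ι) := by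
  rw [mem_indepSubsets, linearIndepOn_dualFamily]
  simp

noncomputable instance : Fintype (IndepSubset X) := by
  classical exact inferInstanceAs (Fintype {I : Finset ι // LinearIndepOn ℝ X (I : Set ι)})

theorem sum_indepSubset {N : Type*} [AddCommMonoid N] (F : Finset ι → N) :
    ∑ I : IndepSubset X, F I.1 = ∑ I ∈ indepSubsets (dualFamily X) Finset.univ, F I :=
  (Finset.sum_subtype _ (fun _ => mem_indepSubsets_dualFamily X) F).symm

variable [LinearOrder ι]

theorem activeComplement_dualFamily (I : Finset ι) :
    activeComplement (dualFamily X) Finset.univ I = complementSet X I := by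
  classical
  ext x
  rw [mem_activeComplement, complementSet, Finset.mem_filter, dualFamily, Set.image_comp,
    Function.comp_apply, map_mem_span_image_iff (v := 0) (by
      rw [Submodule.span_zero_singleton]
      exact LinearEquiv.ker _), Submodule.span_insert_zero]

theorem evalReal_basisPoly (I : IndepSubset X) :
    evalReal n (basisPoly X I) = activeProduct (dualFamily X) Finset.univ I.1 := by
  rw [basisPoly, evalReal_prodForm, activeProduct, activeComplement_dualFamily]

theorem linearIndependent_basisPoly : LinearIndependent ℂ (basisPoly X) := by
  classical
  rw [Fintype.linearIndependent_iff]
  intro g hg I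
  set c : Finset ι → ℂ := fun J =>
    if hJ : LinearIndepOn ℝ X (J : Set ι) then g ⟨J, hJ⟩ else 0 with hc
  have hcg : ∀ J : IndepSubset X, c J.1 = g J := fun J => dif_pos J.2
  rw [← hcg]
  refine (activeProduct_linearIndependent_and_spanning Finset.univ _ (dualFamily X)).1 c ?_ I.1
    ((mem_indepSubsets_dualFamily X).2 I.2)
  rw [← sum_indepSubset X fun J => c J • activeProduct (dualFamily X) Finset.univ J,
    ← map_zero (evalReal n), ← hg, map_sum]
  exact Finset.sum_congr rfl fun J _ => by rw [hcg, map_smul, evalReal_basisPoly]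

theorem span_range_basisPoly : Submodule.span ℂ (Set.range (basisPoly X)) = externalSpace X := by
  refine le_antisymm (Submodule.span_le.2 ?_) (Submodule.span_le.2 ?_)
  · rintro _ ⟨I, rfl⟩
    exact Submodule.subset_span ⟨complementSet X I.1, rfl⟩
  · rintro _ ⟨Y, rfl⟩
    obtain ⟨c, hc⟩ :=
      (activeProduct_linearIndependent_and_spanning Finset.univ _ (dualFamily X)).2 _
        (prod_complexForm_mem_kernelSpace (dualFamily X) (Finset.subset_univ Y))
    have hY : prodForm X Y = ∑ I : IndepSubset X, c I.1 • basisPoly X I := by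
      apply evalReal_injective
      rw [evalReal_prodForm, hc, map_sum,
        ← sum_indepSubset X fun J => c J • activeProduct (dualFamily X) Finset.univ J]
      exact Finset.sum_congr rfl fun J _ => by rw [map_smul, evalReal_basisPoly]
    rw [hY]
    exact Submodule.sum_mem _ fun I _ => Submodule.smul_mem _ _ (Submodule.subset_span ⟨I, rfl⟩)

theorem isHomogeneous_linForm (y : Fin n → ℝ) : (linForm y).IsHomogeneous 1 :=
  MvPolynomial.IsHomogeneous.sum _ _ _ fun i _ => by
    simpa using (MvPolynomial.isHomogeneous_C (Fin n) ((y i : ℝ) : ℂ)).mul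
      (MvPolynomial.isHomogeneous_X ℂ i)

theorem isHomogeneous_basisPoly (I : IndepSubset X) : (basisPoly X I).IsHomogeneous (val X I) := by
  have := MvPolynomial.IsHomogeneous.prod (complementSet X I.1) (fun y => linForm (X y))
    (fun _ => 1) fun y _ => isHomogeneous_linForm (X y)
  simpa [basisPoly, prodForm, val] using this

/-- The homogeneous part of the external space is spanned by the basis elements of that degree. -/
theorem externalSpace_inf_homogeneousSubmodule (j : ℕ) :
    externalSpace X ⊓ MvPolynomial.homogeneousSubmodule (Fin n) ℂ j =
      Submodule.span ℂ (Set.range fun I : {I : IndepSubset X // val X I = j} =>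
        basisPoly X I.1) := by
  refine le_antisymm ?_ (Submodule.span_le.2 ?_)
  · rintro f ⟨hf, hfj⟩
    rw [← span_range_basisPoly] at hf
    obtain ⟨c, rfl⟩ := (Submodule.mem_span_range_iff_exists_fun ℂ).1 hf
    -- Taking the degree j component fixes f and kills the terms with val(I) ≠ j.
    have h := MvPolynomial.homogeneousComponent_of_mem (m := j) (n := j) hfj
    rw [if_pos rfl, map_sum] at h
    rw [← h]
    refine Submodule.sum_mem _ fun I _ => ?_
    rw [map_smul, MvPolynomial.homogeneousComponent_of_mem (isHomogeneous_basisPoly X I)]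
    split_ifs with hI
    · exact Submodule.smul_mem _ _ (Submodule.subset_span ⟨⟨I, hI.symm⟩, rfl⟩)
    · simp
  · rintro _ ⟨I, rfl⟩
    refine ⟨?_, ?_⟩
    · rw [← span_range_basisPoly]
      exact Submodule.subset_span ⟨I.1, rfl⟩
    · have := isHomogeneous_basisPoly X I.1
      rw [I.2] at this
      exact this

end Evaluation

end Zonotopal

theorem mainTheorem6 {n : ℕ} {ι : Type*} [Fintype ι] [LinearOrder ι]
    (X : ι → Fin n → ℝ) (hX0 : ∀ x, X x ≠ 0)
    (hXrank : Submodule.span ℝ (Set.range X) = ⊤) :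
    (∃ b : Module.Basis (Zonotopal.IndepSubset X) ℂ (Zonotopal.externalSpace X),
        ∀ I : Zonotopal.IndepSubset X,
          (b I : MvPolynomial (Fin n) ℂ) = Zonotopal.basisPoly X I) ∧
    (∀ j : ℕ,
        Module.finrank ℂ
          ↥(Zonotopal.externalSpace X ⊓ MvPolynomial.homogeneousSubmodule (Fin n) ℂ j) =
        Zonotopal.externalHilbert X j) := by
  classical
  have hli := Zonotopal.linearIndependent_basisPoly X
  refine ⟨⟨(Module.Basis.span hli).map
    (LinearEquiv.ofEq _ _ (Zonotopal.span_range_basisPoly X)), fun I => ?_⟩, fun j => ?_⟩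
  · simp [Module.Basis.span_apply]
  · rw [Zonotopal.externalSpace_inf_homogeneousSubmodule, Zonotopal.externalHilbert,
      Nat.card_eq_fintype_card]
    exact finrank_span_eq_card (hli.comp _ Subtype.val_injective)
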